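/- For a finite poset $X$, let $\mathcal{K}(X)$ denote its order complex, i.e. the simplicial complex whose simplices are the non-empty chains of $X$; we identify it with its geometric realization. An order-preserving map $f\colon X\to Y$ between finite posets induces a simplicial map $\mathcal{K}(f)\colon \mathcal{K}(X)\to\mathcal{K}(Y)$ which coincides with $f$ on vertices. For $y\in Y$ let $U_y=\{y'\in Y : y'\le y\}$, and give $f^{-1}(U_y)\subseteq X$ the order induced from $X$. Theorem (McCord, Quillen). Let $f\colon X\to Y$ be an order-preserving map between two finite posets. Suppose that for every $y\in Y$ the complex $\mathcal{K}(f^{-1}(U_y))$ is contractible. Then $\mathcal{K}(f)$ is a homotopy equivalence. -/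

import Mathlib

/-- The order complex of a poset: its simplices are the non-empty finite chains. -/
def orderComplex (X : Type*) [PartialOrder X] : AbstractSimplicialComplex X where
  faces := {s | s.Nonempty ∧ IsChain (· ≤ ·) (s : Set X)}
  isRelLowerSet_faces := fun _ hs =>
    ⟨hs.1, fun _ hts ht => ⟨ht, hs.2.mono (Finset.coe_subset.2 hts)⟩⟩
  singleton_mem := fun v => ⟨Finset.singleton_nonempty v, by simp⟩

/-- The geometric realization of a simplicial complex on a finite vertex set, in barycentric
coordinates: the union over the simplices `s` of the convex hulls of the corresponding standard
basis vectors. As a subset of `V → ℝ` it carries the subspace topology. -/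
def geomRealization {V : Type*} [Finite V] (K : AbstractSimplicialComplex V) : Set (V → ℝ) :=
  {w | (∀ v, 0 ≤ w v) ∧ ∃ s ∈ K, (∀ v ∉ s, w v = 0) ∧ ∑ v ∈ s, w v = 1}

/-- A map on vertices is simplicial if it sends simplices to simplices. -/
def IsSimplicialMap {V W : Type*} (K : AbstractSimplicialComplex V)
    (L : AbstractSimplicialComplex W) (φ : V → W) : Prop :=
  open Classical in ∀ s ∈ K, s.image φ ∈ L

/-- Pushing barycentric coordinates forward along a simplicial map respects realizations. -/
theorem map_mem_geomRealization {V W : Type*} [Finite V] [Finite W]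
    {K : AbstractSimplicialComplex V} {L : AbstractSimplicialComplex W} {φ : V → W}
    (hφ : IsSimplicialMap K L φ) {w : V → ℝ} (hw : w ∈ geomRealization K) :
    FunOnFinite.map φ w ∈ geomRealization L := by
  classical
  have : Fintype V := Fintype.ofFinite V
  obtain ⟨hw, s, hs, h0, h1⟩ := hw
  refine ⟨fun b => ?_, s.image φ, ?_, fun b hb => ?_, ?_⟩
  · rw [FunOnFinite.map_apply_apply]
    exact Finset.sum_nonneg fun a _ => hw a
  · convert hφ s hs
  · rw [FunOnFinite.map_apply_apply]
    refine Finset.sum_eq_zero fun a ha => h0 a fun has => hb ?_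
    have hab : φ a = b := by simpa using ha
    exact hab ▸ Finset.mem_image_of_mem φ has
  · rw [← h1, ← Finset.sum_fiberwise_of_maps_to (t := s.image φ) (g := φ)
      (fun a ha => Finset.mem_image_of_mem φ ha)]
    refine Finset.sum_congr rfl fun b _ => ?_
    rw [FunOnFinite.map_apply_apply]
    symm
    refine Finset.sum_subset (fun a ha => ?_) fun a ha hna => h0 a fun has => hna ?_
    · exact Finset.mem_filter.2 ⟨Finset.mem_univ a, (Finset.mem_filter.1 ha).2⟩
    · exact Finset.mem_filter.2 ⟨has, (Finset.mem_filter.1 ha).2⟩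

/-- The map which a simplicial map induces on geometric realizations, affine on each simplex:
the coordinate of the image of `w` at a vertex `b` is the sum of the `w a` with `φ a = b`. -/
noncomputable def geomRealizationMap {V W : Type*} [Finite V] [Finite W]
    {K : AbstractSimplicialComplex V} {L : AbstractSimplicialComplex W} {φ : V → W}
    (hφ : IsSimplicialMap K L φ) : C(geomRealization K, geomRealization L) where
  toFun w := ⟨FunOnFinite.map φ w.1, map_mem_geomRealization hφ w.2⟩
  continuous_toFun :=
    ((FunOnFinite.continuous_map ℝ φ).comp continuous_subtype_val).subtype_mk _

/-- An order preserving map is a simplicial map between order complexes. -/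
theorem OrderHom.isSimplicialMap {X Y : Type*} [PartialOrder X] [PartialOrder Y] (f : X →o Y) :
    IsSimplicialMap (orderComplex X) (orderComplex Y) f := by
  classical
  intro s hs
  obtain ⟨hne, hc⟩ := hs
  refine ⟨hne.image _, ?_⟩
  rw [Finset.coe_image]
  rintro _ ⟨a, ha, rfl⟩ _ ⟨b, hb, rfl⟩ _
  exact (hc.total ha hb).imp (fun h => f.monotone h) (fun h => f.monotone h)

/-- A continuous map is a homotopy equivalence if it has a homotopy inverse. -/
def IsHomotopyEquivalence {A B : Type*} [TopologicalSpace A] [TopologicalSpace B]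
    (g : C(A, B)) : Prop :=
  ∃ e : ContinuousMap.HomotopyEquiv A B, e.toFun = g

/-! The argument is one of contractible carriers. A map into a contractible set extends over a cone,
so a map on the chains of a lower set extends over a finite poset one element at a time: adding a
minimal missing element `p` attaches a cone with apex `p` over the chains strictly below `p`, and
the cone is sent into the contractible set `C p` (`exists_extension_of_carrier`).

Applied to the mapping cylinder of `φ : A →o B`, starting from the source end, this extends a
carried map `h` on `A`. The extension restricts to a map `k` on `B`, and since `a ≤ φ a` in the
cylinder, a prism homotopy gives `h ≃ k ∘ φ` (`exists_factorization_of_carrier`).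

This is used twice. For `f` with `h = id` and carriers `f ⁻¹' Iic y`, it yields `g` with `g ∘ f ≃
id` that maps chains in `Iic y` to the realization of `f ⁻¹' Iic y`. Hence `f ∘ g` preserves each
cone over `Iic y`. For the fold map `Y ⊕ Y → Y`, with `f ∘ g` on one copy and `id` on the other, it
makes both homotopic to the same `k`, so `f ∘ g ≃ id`. -/

open Set Topology Filter

/-! ### Subcomplexes of an order complex -/

/-- The points of the realization of the order complex of `P` whose support lies in `S`. -/
def chainRealization {P : Type*} [PartialOrder P] [Fintype P] (S : Set P) : Set (P → ℝ) :=
  {w | w ∈ stdSimplex ℝ P ∧ (∀ a b, w a ≠ 0 → w b ≠ 0 → a ≤ b ∨ b ≤ a) ∧ ∀ a ∉ S, w a = 0}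

section ChainRealization

variable {P : Type*} [PartialOrder P] [Fintype P]

theorem chainRealization_mono {S T : Set P} (h : S ⊆ T) :
    chainRealization S ⊆ chainRealization T :=
  fun _ hw => ⟨hw.1, hw.2.1, fun a ha => hw.2.2 a fun haS => ha (h haS)⟩

theorem le_one_of_mem_chainRealization {S : Set P} {w : P → ℝ} (hw : w ∈ chainRealization S)
    (a : P) : w a ≤ 1 := by
  rw [← hw.1.2]
  exact Finset.single_le_sum (fun i _ => hw.1.1 i) (Finset.mem_univ a)

/-- For an incomparable pair, the chain condition says that one of two coordinates vanishes, which
is closed. Closedness permits gluing of continuous maps along subcomplexes. -/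
theorem isClosed_chainRealization (S : Set P) : IsClosed (chainRealization S) := by
  have h1 : IsClosed {w : P → ℝ | ∀ a b, w a ≠ 0 → w b ≠ 0 → a ≤ b ∨ b ≤ a} := by
    simp only [ofPred_forall]
    refine isClosed_iInter fun a => isClosed_iInter fun b => ?_
    by_cases hab : a ≤ b ∨ b ≤ a
    · simp [hab]
    · have h : {w : P → ℝ | w a ≠ 0 → w b ≠ 0 → a ≤ b ∨ b ≤ a} =
          {w | w a = 0} ∪ {w | w b = 0} := by
        ext w
        simp only [mem_ofPred_eq, mem_union]
        tauto
      have h2 := ((isClosed_eq (continuous_apply a) continuous_const).union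
        (isClosed_eq (continuous_apply b) continuous_const) :
          IsClosed ({w : P → ℝ | w a = 0} ∪ {w | w b = 0}))
      rw [← h] at h2
      simpa only [ofPred_forall] using h2
  have h2 : IsClosed {w : P → ℝ | ∀ a ∉ S, w a = 0} := by
    simp only [ofPred_forall]
    exact isClosed_iInter fun a => isClosed_iInter fun _ =>
      isClosed_eq (continuous_apply a) continuous_const
  exact (isCompact_stdSimplex ℝ P).isClosed.inter (h1.inter h2)

theorem isCompact_chainRealization (S : Set P) : IsCompact (chainRealization S) :=
  (isCompact_stdSimplex ℝ P).of_isClosed_subset (isClosed_chainRealization S) fun _ hw => hw.1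

theorem chainRealization_univ : chainRealization univ = geomRealization (orderComplex P) := by
  classical
  ext w
  constructor
  · rintro ⟨⟨h0, h1⟩, hc, -⟩
    refine ⟨h0, Finset.univ.filter (w · ≠ 0), ⟨?_, ?_⟩, by simp, ?_⟩
    · by_contra h
      rw [Finset.not_nonempty_iff_eq_empty, Finset.filter_eq_empty_iff] at h
      have : ∑ v, w v = 0 := Finset.sum_eq_zero fun v hv => by simpa using h hv
      linarith
    · intro a ha b hb _
      exact hc a b (by simpa using ha) (by simpa using hb)
    · rw [Finset.sum_filter_ne_zero, h1]
  · rintro ⟨h0, s, ⟨-, hs⟩, hz, h1⟩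
    have hm : ∀ a, w a ≠ 0 → a ∈ s := fun a ha => by
      by_contra h
      exact ha (hz a h)
    refine ⟨⟨h0, ?_⟩, fun a b ha hb => hs.total (hm a ha) (hm b hb), by simp⟩
    rw [← h1]
    exact (Finset.sum_subset (Finset.subset_univ s) fun a _ ha => hz a ha).symm

end ChainRealization

/-! ### Extension of maps with contractible carriers -/

/-- A contraction of a contractible subspace, as a map which is continuous on that subspace. -/
theorem exists_contraction {Z : Type*} [TopologicalSpace Z] {C : Set Z} (hC : ContractibleSpace C) :
    ∃ c ∈ C, ∃ F : Z × ℝ → Z, ContinuousOn F (C ×ˢ univ) ∧ MapsTo F (C ×ˢ univ) C ∧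
      ∀ z ∈ C, F (z, 0) = z ∧ F (z, 1) = c := by
  classical
  obtain ⟨c, ⟨H⟩⟩ := id_nullhomotopic C
  -- Time is clamped to the unit interval; the value off `C` is arbitrary.
  let F : Z × ℝ → Z := fun q =>
    if h : q.1 ∈ C then (H (projIcc 0 1 zero_le_one q.2, ⟨q.1, h⟩) : C) else q.1
  refine ⟨c, c.2, F, ?_, ?_, ?_⟩
  · rw [continuousOn_iff_continuous_domRestrict]
    have : (C ×ˢ univ).domRestrict F = fun q : ↥(C ×ˢ (univ : Set ℝ)) =>
        (H (projIcc 0 1 zero_le_one q.1.2, ⟨q.1.1, (mem_prod.1 q.2).1⟩) : Z) := by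
      ext q
      exact dif_pos (mem_prod.1 q.2).1
    rw [this]
    refine continuous_subtype_val.comp (H.continuous.comp (Continuous.prodMk ?_ ?_))
    · exact continuous_projIcc.comp (continuous_snd.comp continuous_subtype_val)
    · exact (continuous_fst.comp continuous_subtype_val).subtype_mk _
  · rintro q hq
    simp only [F]
    rw [dif_pos hq.1]
    exact Subtype.coe_prop _
  · intro z hz
    simp [F, hz]

/-- The radial projection of a cone with apex `p` to its base. -/
noncomputable def coneProj {P : Type*} [DecidableEq P] (p : P) (w : P → ℝ) : P → ℝ :=
  (1 - w p)⁻¹ • Function.update w p 0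

theorem continuousOn_coneProj {P : Type*} [DecidableEq P] (p : P) :
    ContinuousOn (coneProj p) {w : P → ℝ | w p < 1} := by
  refine ContinuousOn.smul (f := fun w : P → ℝ => (1 - w p)⁻¹)
    (g := fun w => Function.update w p 0) (ContinuousOn.inv₀ ?_ ?_) ?_
  · exact (continuous_const.sub (continuous_apply p)).continuousOn
  · intro w hw
    have : w p < 1 := hw
    linarith
  · exact (continuous_id.update p continuous_const).continuousOn

theorem coneProj_eq_self {P : Type*} [DecidableEq P] {p : P} {w : P → ℝ} (h : w p = 0) :
    coneProj p w = w := by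
  ext a
  by_cases ha : a = p
  · subst ha; simp [coneProj, h]
  · simp [coneProj, h, ha]

section Extension

variable {P : Type*} [PartialOrder P] [Fintype P] {Z : Type*} [TopologicalSpace Z]

theorem coneProj_mem [DecidableEq P] {p : P} {S : Set P} {w : P → ℝ}
    (hw : w ∈ chainRealization (insert p S)) (hp : w p < 1) :
    coneProj p w ∈ chainRealization S := by
  have hval : ∀ a, a ≠ p → coneProj p w a = (1 - w p)⁻¹ * w a := fun a ha => by
    simp [coneProj, ha]
  have hpp : coneProj p w p = 0 := by simp [coneProj]
  have hsup : ∀ a, coneProj p w a ≠ 0 → a ≠ p ∧ w a ≠ 0 := fun a ha => by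
    have hap : a ≠ p := by rintro rfl; exact ha hpp
    rw [hval a hap] at ha
    exact ⟨hap, right_ne_zero_of_mul ha⟩
  have hpos : 0 < 1 - w p := by linarith
  refine ⟨⟨fun a => ?_, ?_⟩, fun a b ha hb => hw.2.1 a b (hsup a ha).2 (hsup b hb).2,
    fun a ha => ?_⟩
  · by_cases hap : a = p
    · rw [hap, hpp]
    · rw [hval a hap]
      exact mul_nonneg (inv_nonneg.2 hpos.le) (hw.1.1 a)
  · have h := Finset.add_sum_erase Finset.univ w (Finset.mem_univ p)
    rw [hw.1.2] at h
    rw [← Finset.add_sum_erase Finset.univ _ (Finset.mem_univ p), hpp,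
      Finset.sum_congr rfl fun a ha => hval a (Finset.ne_of_mem_erase ha), ← Finset.mul_sum]
    field_simp
    linarith
  · by_contra hne
    obtain ⟨hap, hwa⟩ := hsup a hne
    exact hwa (hw.2.2 a (by simp [hap, ha]))

/-- A map from the base of a cone to a contractible subspace extends to the cone. -/
theorem exists_extension_cone {C : Set Z} (hC : ContractibleSpace C) {S : Set P} {p : P}
    (hp : p ∉ S) {k : (P → ℝ) → Z} (hk : ContinuousOn k (chainRealization S))
    (hkC : MapsTo k (chainRealization S) C) :
    ∃ k' : (P → ℝ) → Z, ContinuousOn k' (chainRealization (insert p S)) ∧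
      EqOn k' k (chainRealization S) ∧ MapsTo k' (chainRealization (insert p S)) C := by
  classical
  obtain ⟨c, hc, F, hF, hFC, hF01⟩ := exists_contraction hC
  -- The coordinate `w p` is the height in the cone, used as the time of the contraction. At the
  -- apex the projection is meaningless, and the contraction has reached `c`.
  let k' : (P → ℝ) → Z := fun w => if w p < 1 then F (k (coneProj p w), w p) else c
  have hpos : ∀ {w}, w p < 1 → k' w = F (k (coneProj p w), w p) := fun h => if_pos h
  refine ⟨k', ?_, ?_, ?_⟩
  · intro w hw
    by_cases h1 : w p < 1
    · have hopen : {w : P → ℝ | w p < 1} ∈ 𝓝 w :=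
        (isOpen_lt (continuous_apply p) continuous_const).mem_nhds h1
      rw [← continuousWithinAt_inter hopen]
      have : ContinuousOn (fun w => F (k (coneProj p w), w p))
          (chainRealization (insert p S) ∩ {w | w p < 1}) := by
        refine hF.comp (ContinuousOn.prodMk ?_ ?_) ?_
        · exact hk.comp ((continuousOn_coneProj p).mono inter_subset_right)
            fun w hw => coneProj_mem hw.1 hw.2
        · exact (continuous_apply p).continuousOn
        · exact fun w hw => ⟨hkC (coneProj_mem hw.1 hw.2), mem_univ _⟩
      exact (this w ⟨hw, h1⟩).congr (fun v hv => hpos hv.2) (hpos h1)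
    · have hw1 : w p = 1 := le_antisymm (le_one_of_mem_chainRealization hw p) (not_lt.1 h1)
      have hkw : k' w = c := if_neg h1
      rw [ContinuousWithinAt, hkw]
      intro N hN
      -- The projection to the base has no limit at the apex in general, so `F (z, t)` must tend to
      -- `c` uniformly in `z`; compactness of the image of the base provides this.
      have hcpt : IsCompact (k '' chainRealization S) :=
        (isCompact_chainRealization S).image_of_continuousOn hk
      have hev : ∀ᶠ t in 𝓝 (1 : ℝ), ∀ z ∈ k '' chainRealization S, z ∈ C → F (z, t) ∈ N := by
        refine hcpt.eventually_forall_of_forall_eventually (P := fun t z => z ∈ C → F (z, t) ∈ N) ?_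
        rintro z ⟨v, hv, rfl⟩
        have hz := hkC hv
        have h := hF (k v, 1) ⟨hz, mem_univ _⟩
        rw [ContinuousWithinAt, (hF01 _ hz).2] at h
        have h2 := eventually_nhdsWithin_iff.1 (h.eventually hN)
        have h3 := (continuous_swap.tendsto ((1 : ℝ), k v)).eventually h2
        filter_upwards [h3] with q hq hqC
        exact hq ⟨hqC, mem_univ _⟩
      have ht : Tendsto (fun v : P → ℝ => v p) (𝓝[chainRealization (insert p S)] w) (𝓝 1) := by
        rw [← hw1]
        exact (continuous_apply p).continuousWithinAt
      rw [mem_map]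
      filter_upwards [ht.eventually hev, self_mem_nhdsWithin] with v hv hvS
      by_cases hvp : v p < 1
      · rw [mem_preimage, hpos hvp]
        have hm := coneProj_mem hvS hvp
        exact hv _ ⟨_, hm, rfl⟩ (hkC hm)
      · rw [mem_preimage, show k' v = c from if_neg hvp]
        exact mem_of_mem_nhds hN
  · intro w hw
    have h0 : w p = 0 := hw.2.2 p hp
    rw [hpos (by rw [h0]; exact one_pos), coneProj_eq_self h0, h0]
    exact (hF01 _ (hkC hw)).1
  · intro w hw
    by_cases h1 : w p < 1
    · rw [hpos h1]
      exact hFC ⟨hkC (coneProj_mem hw h1), mem_univ _⟩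
    · rw [show k' w = c from if_neg h1]
      exact hc

/-- In a chain through `p`, another element of `D` cannot lie above `p`, since `D` is lower and
omits `p`. So the new simplices form a cone over the chains below `p`. -/
theorem chainRealization_insert {D : Set P} {p : P} (hD : IsLowerSet D) (hp : p ∉ D) :
    chainRealization (insert p D) =
      chainRealization D ∪ chainRealization (insert p (D ∩ Iio p)) := by
  refine subset_antisymm (fun w hw => ?_) (union_subset
    (chainRealization_mono (subset_insert _ _))
    (chainRealization_mono (insert_subset_insert inter_subset_left)))
  by_cases h0 : w p = 0
  · refine Or.inl ⟨hw.1, hw.2.1, fun a ha => ?_⟩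
    by_cases hap : a = p
    · rwa [hap]
    · exact hw.2.2 a (by simp [hap, ha])
  · refine Or.inr ⟨hw.1, hw.2.1, fun a ha => ?_⟩
    by_contra hwa
    have haD : a ∈ insert p D := by
      by_contra h
      exact hwa (hw.2.2 a h)
    rcases haD with rfl | haD
    · exact ha (mem_insert _ _)
    · refine ha (mem_insert_of_mem _ ⟨haD, ?_⟩)
      rcases hw.2.1 a p hwa h0 with h | h
      · exact lt_of_le_of_ne h fun h' => hp (h' ▸ haD)
      · exact absurd (hD h haD) hp

/-- A map on the part of the order complex supported on a lower set extends to the whole order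
complex, provided that it is carried by an increasing family of contractible subspaces. -/
theorem exists_extension_of_carrier {C : P → Set Z} {T : Set Z} {D₀ : Set P}
    (hC : ∀ p ∉ D₀, ContractibleSpace (C p)) (hCT : ∀ p ∉ D₀, C p ⊆ T)
    (hmono : ∀ p ∉ D₀, ∀ q ∉ D₀, p ≤ q → C p ⊆ C q) (D : Set P) (hD : IsLowerSet D)
    (hD₀ : D₀ ⊆ D) (h : (P → ℝ) → Z) (hh : ContinuousOn h (chainRealization D))
    (hhT : MapsTo h (chainRealization D) T)
    (hhC : ∀ p ∉ D₀, MapsTo h (chainRealization (D ∩ Iic p)) (C p)) :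
    ∃ k : (P → ℝ) → Z, ContinuousOn k (chainRealization univ) ∧
      EqOn k h (chainRealization D) ∧ MapsTo k (chainRealization univ) T ∧
      ∀ p ∉ D₀, MapsTo k (chainRealization (Iic p)) (C p) := by
  classical
  -- `D` grows until it exhausts the finite poset.
  induction D using WellFoundedGT.induction generalizing h with
  | ind D ih =>
  by_cases hne : Dᶜ = ∅
  · rw [compl_empty_iff] at hne
    subst hne
    exact ⟨h, hh, fun _ _ => rfl, hhT, by simpa using hhC⟩
  -- By minimality everything strictly below `p` is already in `D`, so `insert p D` is again lower.
  · obtain ⟨p, hp⟩ := (toFinite Dᶜ).exists_minimal (nonempty_iff_ne_empty.2 hne)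
    have hpD : p ∉ D := hp.1
    have hpD₀ : p ∉ D₀ := fun h => hpD (hD₀ h)
    have hlow : ∀ a, a < p → a ∈ D := fun a ha => by
      by_contra h
      exact ha.not_ge (hp.2 h ha.le)
    have hIic : D ∩ Iio p ⊆ D ∩ Iic p := inter_subset_inter_right _ Iio_subset_Iic_self
    obtain ⟨k₁, hk₁, hk₁e, hk₁C⟩ := exists_extension_cone (hC p hpD₀) (S := D ∩ Iio p)
      (fun h => hpD h.1) (hh.mono (chainRealization_mono inter_subset_left))
      ((hhC p hpD₀).mono_left (chainRealization_mono hIic))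
    let k : (P → ℝ) → Z := fun w => if w p = 0 then h w else k₁ w
    have hkD : EqOn k h (chainRealization D) := fun w hw => if_pos (hw.2.2 p hpD)
    have hkk₁ : EqOn k k₁ (chainRealization (insert p (D ∩ Iio p))) := fun w hw => by
      by_cases h0 : w p = 0
      · refine (if_pos h0).trans (hk₁e ⟨hw.1, hw.2.1, fun a ha => ?_⟩).symm
        by_cases hap : a = p
        · rwa [hap]
        · exact hw.2.2 a (by simpa [hap] using ha)
      · exact if_neg h0
    have hins := chainRealization_insert hD hpD
    obtain ⟨k', hk', hk'e, hk'T, hk'C⟩ := ih (insert p D) (ssubset_insert hpD)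
      (fun a b hba ha => by
        rcases ha with rfl | ha
        · rcases hba.eq_or_lt with rfl | hlt
          · exact mem_insert _ _
          · exact mem_insert_of_mem _ (hlow _ hlt)
        · exact mem_insert_of_mem _ (hD hba ha))
      (hD₀.trans (subset_insert _ _)) k
      (by
        rw [hins]
        exact (hh.congr hkD).union_of_isClosed (hk₁.congr hkk₁) (isClosed_chainRealization _)
          (isClosed_chainRealization _))
      (by
        rw [hins]
        rintro w (hw | hw)
        · rw [hkD hw]
          exact hhT hw
        · rw [hkk₁ hw]
          exact hCT p hpD₀ (hk₁C hw))
      (by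
        intro q hq w hw
        have hw' : w ∈ chainRealization (insert p D) :=
          chainRealization_mono inter_subset_left hw
        rw [hins] at hw'
        rcases hw' with hwD | hwp
        · rw [hkD hwD]
          refine hhC q hq ⟨hw.1, hw.2.1, fun a ha => ?_⟩
          by_contra hwa
          refine ha ⟨?_, ?_⟩
          · by_contra h'
            exact hwa (hwD.2.2 a h')
          · by_contra h'
            exact hwa (hw.2.2 a fun h'' => h' h''.2)
        · by_cases h0 : w p = 0
          · rw [show k w = h w from if_pos h0]
            refine hhC q hq ⟨hw.1, hw.2.1, fun a ha => ?_⟩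
            by_cases hap : a = p
            · rwa [hap]
            · refine hw.2.2 a fun h' => ha ⟨?_, h'.2⟩
              exact h'.1.resolve_left hap
          · rw [hkk₁ hwp]
            -- A point with positive weight at `p` and support in `Iic q` forces `p ≤ q`, whence `C
            -- p ⊆ C q`.
            refine hmono p hpD₀ q hq ?_ (hk₁C hwp)
            by_contra hpq
            exact h0 (hw.2.2 p fun h' => hpq h'.2))
    refine ⟨k', hk', fun w hw => ?_, hk'T, hk'C⟩
    rw [hk'e (chainRealization_mono (subset_insert _ _) hw), hkD hw]

end Extension

/-! ### Pushforward and restriction of barycentric coordinates -/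

section Functoriality

variable {A B : Type*} [Fintype A] [Fintype B]

theorem FunOnFinite.exists_of_map_ne_zero {φ : A → B} {w : A → ℝ} {b : B}
    (h : FunOnFinite.map φ w b ≠ 0) :
    ∃ a, φ a = b ∧ w a ≠ 0 := by
  classical
  rw [FunOnFinite.map_apply_apply] at h
  obtain ⟨a, ha, hwa⟩ := Finset.exists_ne_zero_of_sum_ne_zero h
  exact ⟨a, by simpa using ha, hwa⟩

theorem FunOnFinite.map_nonneg {φ : A → B} {w : A → ℝ} (hw : ∀ a, 0 ≤ w a) (b : B) :
    0 ≤ FunOnFinite.map φ w b := by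
  classical
  rw [FunOnFinite.map_apply_apply]
  exact Finset.sum_nonneg fun a _ => hw a

theorem FunOnFinite.sum_map (φ : A → B) (w : A → ℝ) : ∑ b, FunOnFinite.map φ w b = ∑ a, w a := by
  classical
  simp only [FunOnFinite.map_apply_apply]
  exact Finset.sum_fiberwise Finset.univ φ w

theorem FunOnFinite.map_comp_self {φ : A → B} (hφ : Function.Injective φ) (w : A → ℝ) :
    FunOnFinite.map φ w ∘ φ = w := by
  classical
  ext a
  simp [FunOnFinite.map_apply_apply, Finset.sum_filter, hφ.eq_iff]

theorem FunOnFinite.map_comp_of_support {φ : A → B} (hφ : Function.Injective φ) {w : B → ℝ}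
    (hw : ∀ b ∉ range φ, w b = 0) : FunOnFinite.map φ (w ∘ φ) = w := by
  ext b
  by_cases hb : b ∈ range φ
  · obtain ⟨a, rfl⟩ := hb
    exact congrFun (FunOnFinite.map_comp_self hφ (w ∘ φ)) a
  · rw [hw b hb]
    by_contra h
    obtain ⟨a, rfl, -⟩ := FunOnFinite.exists_of_map_ne_zero h
    exact hb ⟨a, rfl⟩

theorem FunOnFinite.map_map {D : Type*} [Fintype D] (ψ : B → D) (φ : A → B) (w : A → ℝ) :
    FunOnFinite.map ψ (FunOnFinite.map φ w) = FunOnFinite.map (ψ ∘ φ) w :=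
  (congrFun (FunOnFinite.map_comp ψ φ) w).symm

theorem FunOnFinite.map_zero (φ : A → B) : FunOnFinite.map φ (0 : A → ℝ) = 0 :=
  (FunOnFinite.linearMap ℝ ℝ φ).map_zero

variable [PartialOrder A] [PartialOrder B]

theorem map_mem_chainRealization {φ : A → B} (hφ : Monotone φ) {S : Set A} {T : Set B}
    (hST : MapsTo φ S T) {w : A → ℝ} (hw : w ∈ chainRealization S) :
    FunOnFinite.map φ w ∈ chainRealization T := by
  refine ⟨⟨FunOnFinite.map_nonneg hw.1.1, by rw [FunOnFinite.sum_map]; exact hw.1.2⟩,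
    fun b b' hb hb' => ?_, fun b hb => ?_⟩
  · obtain ⟨a, rfl, ha⟩ := FunOnFinite.exists_of_map_ne_zero hb
    obtain ⟨a', rfl, ha'⟩ := FunOnFinite.exists_of_map_ne_zero hb'
    exact (hw.2.1 a a' ha ha').imp (fun h => hφ h) (fun h => hφ h)
  · by_contra h
    obtain ⟨a, rfl, ha⟩ := FunOnFinite.exists_of_map_ne_zero h
    refine hb (hST ?_)
    by_contra h'
    exact ha (hw.2.2 a h')

theorem comp_mem_chainRealization (ι : A ↪o B) {S : Set B} (hS : S ⊆ range ι) {w : B → ℝ}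
    (hw : w ∈ chainRealization S) : w ∘ ι ∈ chainRealization (ι ⁻¹' S) := by
  refine ⟨⟨fun a => hw.1.1 _, ?_⟩, fun a b ha hb => ?_, fun a ha => hw.2.2 _ ha⟩
  · rw [← hw.1.2]
    exact Fintype.sum_of_injective ι ι.injective _ _ (fun b hb => hw.2.2 b fun h => hb (hS h))
      fun _ => rfl
  · simpa using hw.2.1 _ _ ha hb

/-- The part of an order complex supported on a subset is the order complex of that subset. -/
noncomputable def chainRealizationHomeomorph (S : Set A) [Fintype S] :
    chainRealization S ≃ₜ chainRealization (univ : Set S) where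
  toFun w := ⟨w.1 ∘ (↑), by
    have := comp_mem_chainRealization (OrderEmbedding.subtype (· ∈ S)) (S := S)
      (fun a ha => ⟨⟨a, ha⟩, rfl⟩) w.2
    exact chainRealization_mono (subset_univ _) this⟩
  invFun w := ⟨FunOnFinite.map (↑) w.1,
    map_mem_chainRealization (Subtype.mono_coe S) (fun a _ => a.2) w.2⟩
  left_inv w := Subtype.ext <| FunOnFinite.map_comp_of_support Subtype.val_injective fun a ha =>
    w.2.2.2 a fun h => ha ⟨⟨a, h⟩, rfl⟩
  right_inv w := Subtype.ext <| FunOnFinite.map_comp_self Subtype.val_injective w.1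
  continuous_toFun := by
    refine Continuous.subtype_mk (continuous_pi fun a => ?_) _
    exact (continuous_apply (a : A)).comp continuous_subtype_val
  continuous_invFun := Continuous.subtype_mk
    ((FunOnFinite.continuous_map ℝ _).comp continuous_subtype_val) _

/-- Every chain in `Iic p` can be enlarged by `p`, so the realization is star-shaped about the
vertex `p`. -/
theorem contractibleSpace_chainRealization_Iic (p : A) :
    ContractibleSpace (chainRealization (Iic p)) := by
  classical
  have hs : (Pi.single p 1 : A → ℝ) ∈ chainRealization (Iic p) := by
    have hz : ∀ a, (Pi.single p 1 : A → ℝ) a ≠ 0 → a = p := fun a ha => by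
      by_contra h
      exact ha (by simp [h])
    refine ⟨single_mem_stdSimplex ℝ p, fun a b ha hb => ?_, fun a ha => ?_⟩
    · rw [hz a ha, hz b hb]; simp
    · by_contra h
      exact ha (hz a h).le
  refine StarConvex.contractibleSpace (x := Pi.single p 1) ?_ ⟨_, hs⟩
  intro w hw s t hs0 ht0 hst
  have hz : ∀ a, (s • (Pi.single p 1 : A → ℝ) + t • w) a ≠ 0 → a = p ∨ (w a ≠ 0 ∧ a ≤ p) := by
    intro a ha
    by_contra! h
    refine ha ?_
    have hwa : w a = 0 := by
      by_contra h'
      exact h' (hw.2.2 a (h.2 h'))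
    simp [h.1, hwa]
  refine ⟨convex_stdSimplex ℝ A hs.1 hw.1 hs0 ht0 hst, fun a b ha hb => ?_, fun a ha => ?_⟩
  · rcases hz a ha with rfl | ha <;> rcases hz b hb with rfl | hb
    · simp
    · exact Or.inr hb.2
    · exact Or.inl ha.2
    · exact hw.2.1 a b ha.1 hb.1
  · by_contra h
    rcases hz a h with rfl | h
    · exact ha self_mem_Iic
    · exact ha h.2

end Functoriality

/-! ### Prism homotopy between comparable maps -/

section Prism

theorem add_sum_le_sum_of_subset {A : Type*} {w : A → ℝ} (hw : ∀ a, 0 ≤ w a) {a : A} {s : Finset A}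
    (ha : a ∉ s) {s' : Finset A} (hs : ∀ b ∈ s, b ∈ s') (has' : a ∈ s') :
    w a + ∑ b ∈ s, w b ≤ ∑ b ∈ s', w b := by
  classical
  rw [← Finset.sum_insert ha]
  refine Finset.sum_le_sum_of_subset_of_nonneg (fun b hb => ?_) fun b _ _ => hw b
  rcases Finset.mem_insert.1 hb with rfl | hb
  · exact has'
  · exact hs b hb

variable {A B : Type*} [PartialOrder A] [Fintype A] [Fintype B]

/-- The upper part, of total mass `t`, of the mass distribution `w` on a chain. -/
noncomputable def upperPart (t : ℝ) (w : A → ℝ) : A → ℝ :=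
  -- Mass is taken from the top of the chain downwards: `a` receives what remains of `t` after all
  -- elements above it, clamped between `0` and `w a`.
  open Classical in fun a => max 0 (min (w a) (t - ∑ b with a < b, w b))

theorem upperPart_nonneg (t : ℝ) (w : A → ℝ) (a : A) : 0 ≤ upperPart t w a := le_max_left _ _

theorem upperPart_le {w : A → ℝ} (hw : ∀ a, 0 ≤ w a) (t : ℝ) (a : A) : upperPart t w a ≤ w a :=
  max_le (hw a) (min_le_left _ _)

theorem upperPart_zero {w : A → ℝ} (hw : ∀ a, 0 ≤ w a) : upperPart 0 w = 0 := by
  classical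
  ext a
  refine max_eq_left ((min_le_right _ _).trans ?_)
  have : 0 ≤ ∑ b with a < b, w b := Finset.sum_nonneg fun b _ => hw b
  linarith

theorem upperPart_one {w : A → ℝ} (hw : w ∈ stdSimplex ℝ A) : upperPart 1 w = w := by
  classical
  ext a
  have h : w a + ∑ b with a < b, w b ≤ ∑ b, w b :=
    add_sum_le_sum_of_subset hw.1 (by simp) (by simp) (by simp)
  rw [hw.2] at h
  have h2 : w a ≤ 1 - ∑ b with a < b, w b := by linarith
  simp only [upperPart]
  rw [min_eq_left h2, max_eq_right (hw.1 a)]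

/-- If `b` receives anything, the mass strictly above `b` is less than `t`, and that mass includes
`w a` and everything above `a`. -/
theorem upperPart_eq_of_lt {w : A → ℝ} (hw : ∀ a, 0 ≤ w a) {t : ℝ} {a b : A} (hba : b < a)
    (hb : upperPart t w b ≠ 0) : upperPart t w a = w a := by
  classical
  have hpos : 0 < t - ∑ c with b < c, w c := by
    by_contra! h
    exact hb (max_eq_left ((min_le_right _ _).trans h))
  have h : w a + ∑ c with a < c, w c ≤ ∑ c with b < c, w c :=
    add_sum_le_sum_of_subset hw (by simp) (by simpa using fun c hc => hba.trans hc) (by simpa using hba)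
  have h2 : w a ≤ t - ∑ c with a < c, w c := by linarith
  simp only [upperPart]
  rw [min_eq_left h2, max_eq_right (hw a)]

/-- The homotopy between the maps of order complexes induced by comparable maps of posets. -/
noncomputable def prismMap (f g : A → B) (q : ℝ × (A → ℝ)) : B → ℝ :=
  FunOnFinite.map f (q.2 - upperPart q.1 q.2) + FunOnFinite.map g (upperPart q.1 q.2)

theorem continuous_prismMap (f g : A → B) : Continuous (prismMap f g) := by
  classical
  have h : Continuous fun q : ℝ × (A → ℝ) => upperPart q.1 q.2 := by
    refine continuous_pi fun a => ?_
    unfold upperPart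
    fun_prop
  exact ((FunOnFinite.continuous_map ℝ f).comp (continuous_snd.sub h)).add
    ((FunOnFinite.continuous_map ℝ g).comp h)

theorem prismMap_zero (f g : A → B) {w : A → ℝ} (hw : w ∈ stdSimplex ℝ A) :
    prismMap f g (0, w) = FunOnFinite.map f w := by
  simp [prismMap, upperPart_zero hw.1, FunOnFinite.map_zero]

theorem prismMap_one (f g : A → B) {w : A → ℝ} (hw : w ∈ stdSimplex ℝ A) :
    prismMap f g (1, w) = FunOnFinite.map g w := by
  simp [prismMap, upperPart_one hw, FunOnFinite.map_zero]

theorem prismMap_mem [PartialOrder B] {f g : A → B} (hf : Monotone f) (hg : Monotone g)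
    (hfg : f ≤ g) (t : ℝ) {w : A → ℝ} (hw : w ∈ chainRealization univ) : prismMap f g (t, w) ∈ chainRealization univ := by
  have hsub : ∀ a, 0 ≤ (w - upperPart t w) a := fun a => sub_nonneg.2 (upperPart_le hw.1.1 t a)
  have hsupp : ∀ a, upperPart t w a ≠ 0 → w a ≠ 0 := fun a ha h0 =>
    ha (le_antisymm (h0 ▸ upperPart_le hw.1.1 t a) (upperPart_nonneg t w a))
  have hsupp' : ∀ a, (w - upperPart t w) a ≠ 0 → w a ≠ 0 := fun a ha h0 => by
    have h1 := upperPart_le hw.1.1 t a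
    have h2 := upperPart_nonneg t w a
    refine ha ?_
    simp only [Pi.sub_apply]
    linarith
  have hb : ∀ b, prismMap f g (t, w) b ≠ 0 →
      (∃ a, f a = b ∧ (w - upperPart t w) a ≠ 0) ∨ ∃ a, g a = b ∧ upperPart t w a ≠ 0 := by
    intro b hb
    by_cases h : FunOnFinite.map f (w - upperPart t w) b = 0
    · refine Or.inr (FunOnFinite.exists_of_map_ne_zero fun h' => hb ?_)
      simp [prismMap, h, h']
    · exact Or.inl (FunOnFinite.exists_of_map_ne_zero h)
  -- If `a' < a` and `a'` meets the upper part, then all the mass at `a` is in the upper part. So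
  -- the lower support lies weakly below the upper one, and `f ≤ g` makes the union of the images a
  -- chain.
  have hlt : ∀ a a', (w - upperPart t w) a ≠ 0 → upperPart t w a' ≠ 0 → f a ≤ g a' := by
    intro a a' ha ha'
    rcases hw.2.1 a a' (hsupp' a ha) (hsupp a' ha') with h | h
    · exact (hf h).trans (hfg a')
    · rcases h.eq_or_lt with rfl | h
      · exact hfg a'
      · exact absurd (sub_eq_zero.2 (upperPart_eq_of_lt hw.1.1 h ha').symm) ha
  refine ⟨⟨fun b => add_nonneg (FunOnFinite.map_nonneg hsub b)
    (FunOnFinite.map_nonneg (upperPart_nonneg t w) b), ?_⟩, fun b b' hb1 hb2 => ?_, by simp⟩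
  · simp only [prismMap, Pi.add_apply, Finset.sum_add_distrib, FunOnFinite.sum_map]
    simp [hw.1.2]
  · rcases hb b hb1 with ⟨a, rfl, ha⟩ | ⟨a, rfl, ha⟩ <;>
      rcases hb b' hb2 with ⟨a', rfl, ha'⟩ | ⟨a', rfl, ha'⟩
    · exact (hw.2.1 a a' (hsupp' a ha) (hsupp' a' ha')).imp (fun h => hf h) (fun h => hf h)
    · exact Or.inl (hlt a a' ha ha')
    · exact Or.inr (hlt a' a ha' ha)
    · exact (hw.2.1 a a' (hsupp a ha) (hsupp a' ha')).imp (fun h => hg h) (fun h => hg h)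

end Prism

/-! ### The mapping cylinder of an order-preserving map -/

/-- The disjoint union of the source and the target of `φ`, ordered by `a ≤ b` if `φ a ≤ b`. -/
def MappingCylinder {A B : Type*} [PartialOrder A] [PartialOrder B] (_φ : A →o B) := A ⊕ B

namespace MappingCylinder

variable {A B : Type*} [PartialOrder A] [PartialOrder B] (φ : A →o B)

/-- The order relation of the mapping cylinder. -/
def Le : A ⊕ B → A ⊕ B → Prop
  | .inl a, .inl a' => a ≤ a'
  | .inl a, .inr b => φ a ≤ b
  | .inr _, .inl _ => False
  | .inr b, .inr b' => b ≤ b'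

instance : PartialOrder (MappingCylinder φ) where
  le := Le φ
  le_refl x := by rcases x with a | b <;> simp [Le]
  le_trans x y z hxy hyz := by
    rcases x with a | b <;> rcases y with a' | b' <;> rcases z with a'' | b'' <;>
      simp only [Le] at hxy hyz ⊢
    · exact hxy.trans hyz
    · exact (φ.monotone hxy).trans hyz
    · exact hxy.trans hyz
    · exact hxy.trans hyz
  le_antisymm x y hxy hyx := by
    rcases x with a | b <;> rcases y with a' | b' <;> simp only [Le] at hxy hyx
    · rw [hxy.antisymm hyx]
    · rw [hxy.antisymm hyx]

instance [Fintype A] [Fintype B] : Fintype (MappingCylinder φ) :=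
  inferInstanceAs (Fintype (A ⊕ B))

/-- The inclusion of the source in the mapping cylinder. -/
def inl : A ↪o MappingCylinder φ where
  toFun := Sum.inl
  inj' := Sum.inl_injective
  map_rel_iff' := Iff.rfl

/-- The inclusion of the target in the mapping cylinder. -/
def inr : B ↪o MappingCylinder φ where
  toFun := Sum.inr
  inj' := Sum.inr_injective
  map_rel_iff' := Iff.rfl

theorem inl_le_inr (a : A) (b : B) : inl φ a ≤ inr φ b ↔ φ a ≤ b := Iff.rfl

theorem not_inr_le_inl (a : A) (b : B) : ¬ inr φ b ≤ inl φ a := id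

theorem eq_inr_of_notMem {p : MappingCylinder φ} (hp : p ∉ range (inl φ)) : ∃ b, p = inr φ b := by
  rcases p with a | b
  · exact absurd ⟨a, rfl⟩ hp
  · exact ⟨b, rfl⟩

theorem inr_notMem (b : B) : inr φ b ∉ range (inl φ) := by
  rintro ⟨a, ha⟩
  exact not_inr_le_inl φ a b ha.ge

theorem isLowerSet_range_inl : IsLowerSet (range (inl φ)) := by
  rintro _ p hp ⟨a, rfl⟩
  by_contra h
  obtain ⟨b, rfl⟩ := eq_inr_of_notMem φ h
  exact not_inr_le_inl φ a b hp

/-- A carrier for maps on the target, regarded as a carrier on the mapping cylinder. -/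
def carrier {Z : Type*} (C : B → Set Z) (p : MappingCylinder φ) : Set Z :=
  Sum.elim (fun _ => univ) C p

end MappingCylinder

/-! ### Factorization up to homotopy and its consequences -/

/-- A map on the source of `φ` which is carried by an increasing family of contractible subspaces
indexed by the target factors through `φ` up to homotopy, by a map which is carried as well. -/
theorem exists_factorization_of_carrier {A B : Type*} [PartialOrder A] [PartialOrder B] [Fintype A]
    [Fintype B] (φ : A →o B) {Z : Type*} [TopologicalSpace Z] {T : Set Z} {C : B → Set Z}
    (hC : ∀ b, ContractibleSpace (C b)) (hCT : ∀ b, C b ⊆ T) (hmono : Monotone C)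
    {h : (A → ℝ) → Z} (hh : ContinuousOn h (chainRealization univ))
    (hhT : MapsTo h (chainRealization univ) T)
    (hhC : ∀ b, MapsTo h (chainRealization (φ ⁻¹' Iic b)) (C b)) :
    ∃ k : (B → ℝ) → Z, ContinuousOn k (chainRealization univ) ∧ MapsTo k (chainRealization univ) T ∧
      (∀ b, MapsTo k (chainRealization (Iic b)) (C b)) ∧
      ∃ G : ℝ × (A → ℝ) → Z, ContinuousOn G (univ ×ˢ chainRealization univ) ∧
        MapsTo G (univ ×ˢ chainRealization univ) T ∧
        ∀ w ∈ chainRealization univ, G (0, w) = h w ∧ G (1, w) = k (FunOnFinite.map φ w) := by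
  let i := MappingCylinder.inl φ
  let j := MappingCylinder.inr φ
  have hcomp : MapsTo (fun w : MappingCylinder φ → ℝ => w ∘ i) (chainRealization (range i))
      (chainRealization univ) := fun w hw =>
    chainRealization_mono (subset_univ _) (comp_mem_chainRealization i subset_rfl hw)
  have hcont : Continuous fun w : MappingCylinder φ → ℝ => w ∘ i :=
    continuous_pi fun a => continuous_apply (i a)
  -- The elements of the source below `inr b` form `φ ⁻¹' Iic b`, where `h` is carried by `C b`. The
  -- carrier's value on the source plays no role, as `D₀ = range i`.
  obtain ⟨k, hk, hke, hkT, hkC⟩ := exists_extension_of_carrier (T := T) (D₀ := range i)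
    (C := MappingCylinder.carrier φ C)
    (fun p hp => by
      obtain ⟨b, rfl⟩ := MappingCylinder.eq_inr_of_notMem φ hp
      exact hC b)
    (fun p hp => by
      obtain ⟨b, rfl⟩ := MappingCylinder.eq_inr_of_notMem φ hp
      exact hCT b)
    (fun p hp q hq hpq => by
      obtain ⟨b, rfl⟩ := MappingCylinder.eq_inr_of_notMem φ hp
      obtain ⟨b', rfl⟩ := MappingCylinder.eq_inr_of_notMem φ hq
      exact hmono ((MappingCylinder.inr φ).le_iff_le.1 hpq))
    (range i) (MappingCylinder.isLowerSet_range_inl φ) subset_rfl (fun w => h (w ∘ i))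
    (hh.comp hcont.continuousOn hcomp) (fun w hw => hhT (hcomp hw))
    (fun p hp w hw => by
      obtain ⟨b, rfl⟩ := MappingCylinder.eq_inr_of_notMem φ hp
      have := comp_mem_chainRealization i inter_subset_left hw
      exact hhC b (chainRealization_mono (fun a ha => ha.2) this))
  -- This comparison makes the two inclusions of `A` homotopic in the cylinder; composing with `k`
  -- gives the required `G`.
  have hij : (i : A → MappingCylinder φ) ≤ j ∘ φ := fun a =>
    (MappingCylinder.inl_le_inr φ a _).2 le_rfl
  have hprism : MapsTo (prismMap i (j ∘ φ)) (univ ×ˢ chainRealization univ)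
      (chainRealization univ) := fun q hq =>
    prismMap_mem i.monotone (j.monotone.comp φ.monotone) hij q.1 hq.2
  have hj : MapsTo (FunOnFinite.map (M := ℝ) j) (chainRealization univ) (chainRealization univ) :=
    fun w hw => map_mem_chainRealization j.monotone (mapsTo_univ _ _) hw
  refine ⟨k ∘ FunOnFinite.map j, hk.comp (FunOnFinite.continuous_map ℝ j).continuousOn hj,
    hkT.comp hj, fun b w hw => ?_, k ∘ prismMap i (j ∘ φ),
    hk.comp (continuous_prismMap _ _).continuousOn hprism, hkT.comp hprism, fun w hw => ⟨?_, ?_⟩⟩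
  · exact hkC (j b) (MappingCylinder.inr_notMem φ b)
      (map_mem_chainRealization j.monotone (fun b' hb' => j.monotone hb') hw)
  · rw [Function.comp_apply, prismMap_zero _ _ hw.1,
      hke (map_mem_chainRealization i.monotone (fun a _ => mem_range_self a) hw)]
    exact congrArg h (FunOnFinite.map_comp_self i.injective w)
  · rw [Function.comp_apply, Function.comp_apply, prismMap_one _ _ hw.1, FunOnFinite.map_map]

theorem homotopic_of_continuousOn {V Z : Type*} [TopologicalSpace V] [TopologicalSpace Z]
    {S : Set V} {T : Set Z} {G : ℝ × V → Z} (hG : ContinuousOn G (univ ×ˢ S))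
    (hGT : MapsTo G (univ ×ˢ S) T) (u v : C(S, T)) (h0 : ∀ w : S, G (0, w) = u w)
    (h1 : ∀ w : S, G (1, w) = v w) : u.Homotopic v := by
  let e : unitInterval × S → ↥((univ : Set ℝ) ×ˢ S) := fun q => ⟨(q.1, q.2), mem_univ _, q.2.2⟩
  have he : Continuous e := by
    refine Continuous.subtype_mk ?_ _
    fun_prop
  exact ⟨{
    toFun := fun q => ⟨G (q.1, q.2), hGT (e q).2⟩
    continuous_toFun := ((continuousOn_iff_continuous_domRestrict.1 hG).comp he).subtype_mk _
    map_zero_left := fun w => Subtype.ext (h0 w)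
    map_one_left := fun w => Subtype.ext (h1 w) }⟩

/-- A self-map of an order complex which sends each lower cone into itself is homotopic to the
identity. -/
theorem exists_homotopic_id_of_mapsTo_Iic {Y : Type*} [PartialOrder Y] [Fintype Y]
    {u : (Y → ℝ) → Y → ℝ} (hu : ContinuousOn u (chainRealization univ))
    (huC : ∀ y, MapsTo u (chainRealization (Iic y)) (chainRealization (Iic y)))
    (huT : MapsTo u (chainRealization univ) (chainRealization univ)) :
    ContinuousMap.Homotopic
      (⟨huT.restrict, hu.mapsToRestrict huT⟩ :
        C(chainRealization (univ : Set Y), chainRealization univ))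
      (ContinuousMap.id _) := by
  classical
  have hfold : Monotone (Sum.elim id id : Y ⊕ Y → Y) := by
    rintro (a | a) (b | b) h
    · exact Sum.inl_le_inl_iff.1 h
    · exact absurd h Sum.not_inl_le_inr
    · exact absurd h Sum.not_inr_le_inl
    · exact Sum.inr_le_inr_iff.1 h
  -- The two copies of `Y` are mutually incomparable, so a map on the sum is an independent choice
  -- on each copy.
  let φ : Y ⊕ Y →o Y := ⟨Sum.elim id id, hfold⟩
  let i : Y ↪o Y ⊕ Y := ⟨⟨Sum.inl, Sum.inl_injective⟩, Sum.inl_le_inl_iff⟩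
  let j : Y ↪o Y ⊕ Y := ⟨⟨Sum.inr, Sum.inr_injective⟩, Sum.inr_le_inr_iff⟩
  have hi : MapsTo (FunOnFinite.map (M := ℝ) i) (chainRealization univ)
      (chainRealization (range i)) :=
    fun w hw => map_mem_chainRealization i.monotone (fun a _ => mem_range_self a) hw
  have hj : MapsTo (FunOnFinite.map (M := ℝ) j) (chainRealization univ)
      (chainRealization (range j)) :=
    fun w hw => map_mem_chainRealization j.monotone (fun a _ => mem_range_self a) hw
  have hsplit : ∀ S : Set (Y ⊕ Y), chainRealization S =
      chainRealization (S ∩ range i) ∪ chainRealization (S ∩ range j) := by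
    intro S
    refine subset_antisymm (fun w hw => ?_) (union_subset (chainRealization_mono inter_subset_left)
      (chainRealization_mono inter_subset_left))
    by_cases h : ∃ y, w (Sum.inl y) ≠ 0
    · obtain ⟨y, hy⟩ := h
      refine Or.inl ⟨hw.1, hw.2.1, fun a ha => ?_⟩
      by_contra hwa
      have haS : a ∈ S := by
        by_contra h
        exact hwa (hw.2.2 a h)
      rcases a with a | a
      · exact ha ⟨haS, a, rfl⟩
      · rcases hw.2.1 _ _ hy hwa with h | h
        · exact Sum.not_inl_le_inr h
        · exact Sum.not_inr_le_inl h
    · push Not at h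
      refine Or.inr ⟨hw.1, hw.2.1, fun a ha => ?_⟩
      rcases a with a | a
      · exact h a
      · exact hw.2.2 _ fun haS => ha ⟨haS, a, rfl⟩
  -- The identity on the left copy and `u` on the right one. The two cases are exclusive because the
  -- total mass is `1`.
  let h : (Y ⊕ Y → ℝ) → Y → ℝ := fun w => if ∀ y, w (Sum.inl y) = 0 then u (w ∘ j) else w ∘ i
  have hinl : EqOn h (fun w => w ∘ i) (chainRealization (range i)) := fun w hw => by
    refine if_neg fun h0 => ?_
    have hsum := hw.1.2
    rw [Fintype.sum_sum_type, Finset.sum_eq_zero fun y _ => h0 y, Finset.sum_eq_zero fun y _ =>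
      hw.2.2 (Sum.inr y) (by rintro ⟨a, ha⟩; exact Sum.inl_ne_inr ha)] at hsum
    norm_num at hsum
  have hinr : EqOn h (fun w => u (w ∘ j)) (chainRealization (range j)) := fun w hw =>
    if_pos fun y => hw.2.2 (Sum.inl y) (by rintro ⟨a, ha⟩; exact Sum.inr_ne_inl ha)
  have hmi : ∀ S, MapsTo (fun w : Y ⊕ Y → ℝ => w ∘ i) (chainRealization (S ∩ range i))
      (chainRealization (i ⁻¹' S)) := fun S w hw =>
    chainRealization_mono (fun a ha => ha.1) (comp_mem_chainRealization i inter_subset_right hw)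
  have hmj : ∀ S, MapsTo (fun w : Y ⊕ Y → ℝ => w ∘ j) (chainRealization (S ∩ range j))
      (chainRealization (j ⁻¹' S)) := fun S w hw =>
    chainRealization_mono (fun a ha => ha.1) (comp_mem_chainRealization j inter_subset_right hw)
  have hmaps : ∀ (S : Set (Y ⊕ Y)) (T : Set (Y → ℝ)), chainRealization (i ⁻¹' S) ⊆ T →
      MapsTo u (chainRealization (j ⁻¹' S)) T → MapsTo h (chainRealization S) T := by
    intro S T hST huST w hw
    rw [hsplit] at hw
    rcases hw with hw | hw
    · rw [hinl (chainRealization_mono inter_subset_right hw)]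
      exact hST (hmi S hw)
    · rw [hinr (chainRealization_mono inter_subset_right hw)]
      exact huST (hmj S hw)
  have hh : ContinuousOn h (chainRealization univ) := by
    rw [hsplit, univ_inter, univ_inter]
    refine ContinuousOn.union_of_isClosed (ContinuousOn.congr ?_ hinl) (ContinuousOn.congr ?_ hinr)
      (isClosed_chainRealization _) (isClosed_chainRealization _)
    · exact (continuous_pi fun a => continuous_apply (i a)).continuousOn
    · refine hu.comp (continuous_pi fun a => continuous_apply (j a)).continuousOn fun w hw => ?_
      exact hmj univ (by rwa [univ_inter])
  obtain ⟨k, hk, hkT, -, G, hG, hGT, hG01⟩ := exists_factorization_of_carrier φ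
    (T := chainRealization univ) (C := fun y => chainRealization (Iic y))
    contractibleSpace_chainRealization_Iic (fun y => chainRealization_mono (subset_univ _))
    (fun a b hab => chainRealization_mono (Iic_subset_Iic.2 hab)) hh
    (hmaps _ _ (chainRealization_mono (subset_univ _)) huT)
    (fun y => hmaps _ _ subset_rfl (huC y))
  let k' : C(chainRealization (univ : Set Y), chainRealization univ) :=
    ⟨hkT.restrict, hk.mapsToRestrict hkT⟩
  -- Along either section of the fold map, the homotopy `G` runs from the map chosen on that copy to
  -- the common `k`.
  have key : ∀ (ι : Y ↪o Y ⊕ Y), (∀ y, φ (ι y) = y) →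
      ∀ v : C(chainRealization (univ : Set Y), chainRealization univ),
      (∀ w : chainRealization (univ : Set Y), h (FunOnFinite.map ι w.1) = v w) → v.Homotopic k' := by
    intro ι hι v hv
    have hm : MapsTo (FunOnFinite.map (M := ℝ) ι) (chainRealization univ)
        (chainRealization univ) :=
      fun w hw => map_mem_chainRealization ι.monotone (mapsTo_univ _ _) hw
    have hm' : MapsTo (fun q : ℝ × (Y → ℝ) => (q.1, FunOnFinite.map ι q.2))
        (univ ×ˢ chainRealization univ) (univ ×ˢ chainRealization univ) :=
      fun q hq => ⟨mem_univ _, hm hq.2⟩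
    refine homotopic_of_continuousOn
      (hG.comp (continuous_fst.prodMk
        ((FunOnFinite.continuous_map ℝ ι).comp continuous_snd)).continuousOn hm')
      (hGT.comp hm') v k' (fun w => ?_) (fun w => ?_)
    · exact (hG01 _ (hm w.2)).1.trans (hv w)
    · refine (hG01 _ (hm w.2)).2.trans ?_
      rw [FunOnFinite.map_map, show (φ ∘ ι : Y → Y) = id from funext hι, FunOnFinite.map_id]
      rfl
  refine (key j (fun _ => rfl) _ fun w => ?_).trans (key i (fun _ => rfl) _ fun w => ?_).symm
  · rw [hinr (hj w.2)]
    exact congrArg u (FunOnFinite.map_comp_self j.injective w.1)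
  · rw [hinl (hi w.2)]
    exact FunOnFinite.map_comp_self i.injective w.1

/-! ### The theorem of McCord and Quillen -/

theorem IsHomotopyEquivalence.of_set_eq {V Z : Type*} [TopologicalSpace V] [TopologicalSpace Z]
    {S S' : Set V} {T T' : Set Z} (hS : S = S') (hT : T = T') {u : C(S, T)} {v : C(S', T')}
    (huv : ∀ (w : V) (hw : w ∈ S) (hw' : w ∈ S'), (u ⟨w, hw⟩ : Z) = v ⟨w, hw'⟩)
    (hu : IsHomotopyEquivalence u) : IsHomotopyEquivalence v := by
  subst hS hT
  rwa [show v = u from ContinuousMap.ext fun w => Subtype.ext (huv w.1 w.2 w.2).symm]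

theorem theorem1p1 {X Y : Type*} [PartialOrder X] [PartialOrder Y] [Finite X] [Finite Y]
    (f : X →o Y)
    (hf : ∀ y : Y, ContractibleSpace (geomRealization (orderComplex (f ⁻¹' Set.Iic y)))) :
    IsHomotopyEquivalence (geomRealizationMap f.isSimplicialMap) := by
  classical
  have := Fintype.ofFinite X
  have := Fintype.ofFinite Y
  have hC : ∀ y, ContractibleSpace (chainRealization (f ⁻¹' Iic y)) := fun y => by
    have := hf y
    rw [← chainRealization_univ] at this
    exact (chainRealizationHomeomorph _).contractibleSpace
  obtain ⟨g, hg, hgT, hgC, G, hG, hGT, hG01⟩ := exists_factorization_of_carrier f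
    (T := chainRealization univ) (C := fun y => chainRealization (f ⁻¹' Iic y)) hC
    (fun y => chainRealization_mono (subset_univ _))
    (fun a b hab => chainRealization_mono (preimage_mono (Iic_subset_Iic.2 hab)))
    (h := id) continuousOn_id (mapsTo_id _) (fun y => mapsTo_id _)
  have hfm : ∀ S : Set Y, MapsTo (FunOnFinite.map (M := ℝ) f) (chainRealization (f ⁻¹' S))
      (chainRealization S) := fun S w hw => map_mem_chainRealization f.monotone (fun a ha => ha) hw
  -- `g` sends the cone of `Iic y` into the realization of `f ⁻¹' Iic y`, and `f` sends that back
  -- into the cone.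
  have hfg := exists_homotopic_id_of_mapsTo_Iic (u := FunOnFinite.map f ∘ g)
    ((FunOnFinite.continuous_map ℝ f).comp_continuousOn hg)
    (fun y => (hfm _).comp (hgC y)) ((hfm univ).comp hgT)
  let f' : C(chainRealization (univ : Set X), chainRealization (univ : Set Y)) :=
    ⟨(hfm univ).restrict, (FunOnFinite.continuous_map ℝ f).continuousOn.mapsToRestrict (hfm univ)⟩
  let g' : C(chainRealization (univ : Set Y), chainRealization (univ : Set X)) :=
    ⟨hgT.restrict, hg.mapsToRestrict hgT⟩
  have hgf : (ContinuousMap.id _).Homotopic (g'.comp f') := homotopic_of_continuousOn hG hGT _ _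
    (fun w => (hG01 w w.2).1) fun w => (hG01 w w.2).2
  exact IsHomotopyEquivalence.of_set_eq chainRealization_univ chainRealization_univ
    (u := f') (fun _ _ _ => rfl) ⟨⟨f', g', hgf.symm, hfg⟩, rfl⟩
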